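/- Let $K\ge 0$, $p\ge 1$ be integers and let $q$ be a prime with $q>(p-1)^2K$. Let $\mathbf S=(S_1,\dots,S_K)$ be a random vector on $\{0,\dots,p-1\}^K$ with an arbitrary joint distribution, and let $\mathbf s[1],\mathbf s[2],\dots$ be independent copies of $\mathbf S$. Consider the $K$-user modulo-$q$ sum channel $\mathbf y=\mathbf x_1+\dots+\mathbf x_K$ with $\mathbf x_i\in\mathbb F_q^n$, addition being in $\mathbb F_q^n$. For a function $f$ on $\{0,\dots,p-1\}^K$, a length-$n$ block code for $k$ source symbols consists of encoders, $\mathbf x_i=\psi_i(s_i[1],\dots,s_i[k])\in\mathbb F_q^n$ for $i=1,\dots,K$, and decoders, $\hat f_j=\varphi_j(\mathbf y)$ for $j=1,\dots,k$. Its error probability is $\Pr[\hat f_j\ne f(\mathbf s[j])\text{ for some }j\le k]$. A rate $R\in[0,\infty]$ is achievable for $f$ if there are integers $k_n\ge 0$ and length-$n$ block codes for $k_n$ source symbols ($n=1,2,\dots$) such that $k_n/n\to R$ and the error probability tends to $0$ as $n\to\infty$. The computation capacity of $f$ is the maximum of all achievable rates. Then for each of the following functions the computation capacity exists and equals $$\frac{\log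 q}{H(f(\mathbf S))},$$ where $H$ is the Shannon entropy, with logarithm to the same base as in the numerator, and the quotient is read as $+\infty$ if $H(f(\mathbf S))=0$: 1. the arithmetic sum function $f(\mathbf s)=\bigl(\sum_{i=1}^K a_{li}s_i\bigr)_{l=1}^L$ (sums of integers), for every $L\ge 0$ and all weights $a_{li}\in\{0,\dots,p-1\}$; 2. the type function $f(\mathbf s)=\bigl(|\{i: s_i=l\}|\bigr)_{l=0}^{p-1}$. -/

import Mathlib

open Filter Topology
open scoped ENNReal

namespace ModSumChannel

/-- The weighted arithmetic sum function with weights `a l i ∈ {0, …, p - 1}`: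
`s ↦ (∑ i, a l i * s i)_l`, the sums being taken in the integers. -/
def arithSum {K p L : ℕ} (a : Fin L → Fin K → Fin p) (s : Fin K → Fin p) : Fin L → ℕ :=
  fun l => ∑ i, (a l i : ℕ) * (s i : ℕ)

/-- The type (frequency histogram) function: `s ↦ (#{i | s i = l})_l`. -/
def typeFun {K p : ℕ} (s : Fin K → Fin p) : Fin p → ℕ :=
  fun l => ∑ i, if s i = l then 1 else 0

/-- Shannon entropy (in nats) of a discrete distribution, as an element of `[0, ∞]`.
Each summand `-μ(y) log μ(y)` is nonnegative, so no truncation takes place. -/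
noncomputable def entropy {β : Type*} (μ : PMF β) : ℝ≥0∞ :=
  ∑' y, ENNReal.ofReal (Real.negMulLog (μ y).toReal)

/-- A block code of length `n` for `k` source symbols over the `K`-user modulo-`q` sum channel:
sender `i` maps its own source block in `{0, …, p - 1}^k` to a channel input in `𝔽_q^n`, and the
`j`-th decoding map estimates the `j`-th function value from the channel output in `𝔽_q^n`. -/
structure BlockCode (K p q n k : ℕ) (β : Type*) where
  encode : Fin K → (Fin k → Fin p) → (Fin n → ZMod q)
  decode : Fin k → (Fin n → ZMod q) → β

namespace BlockCode

variable {K p q n k : ℕ} {β : Type*}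

/-- The channel output when the sources at time `j` are `s j = (s j 1, …, s j K)`: the sum in
`𝔽_q^n` of the inputs of all senders, where sender `i` sees only `j ↦ s j i`. -/
def output (C : BlockCode K p q n k β) (s : Fin k → Fin K → Fin p) : Fin n → ZMod q :=
  ∑ i, C.encode i (fun j => s j i)

open Classical in
/-- The probability that some estimate `decode j y` differs from `f (s j)`, where `s 1, …, s k`
are independent with common law `P`. -/
noncomputable def errorProb (C : BlockCode K p q n k β) (P : PMF (Fin K → Fin p))
    (f : (Fin K → Fin p) → β) : ℝ≥0∞ :=
  ∑ s : Fin k → Fin K → Fin p,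
    if ∃ j, C.decode j (C.output s) ≠ f (s j) then ∏ j, P (s j) else 0

end BlockCode

/-- `R ∈ [0, ∞]` is an achievable computation rate for `f`: some sequence of codes, the `n`-th of
which has length `n` and serves `k n` source symbols, has rates `k n / n` converging to `R` and
error probabilities converging to zero. -/
def IsAchievable {K p : ℕ} {β : Type*} (q : ℕ) (P : PMF (Fin K → Fin p))
    (f : (Fin K → Fin p) → β) (R : ℝ≥0∞) : Prop :=
  ∃ (k : ℕ → ℕ) (C : ∀ n, BlockCode K p q n (k n) β),
    Tendsto (fun n => (k n : ℝ≥0∞) / (n : ℝ≥0∞)) atTop (𝓝 R) ∧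
    Tendsto (fun n => (C n).errorProb P f) atTop (𝓝 0)

/-- `R` is the computation capacity: the maximum of all achievable computation rates. -/
def IsComputationCapacity {K p : ℕ} {β : Type*} (q : ℕ) (P : PMF (Fin K → Fin p))
    (f : (Fin K → Fin p) → β) (R : ℝ≥0∞) : Prop :=
  IsGreatest {R' : ℝ≥0∞ | IsAchievable q P f R'} R

end ModSumChannel

/-! Each function is a sum of one-sender maps whose values, `p = 1` aside, have entries in `{0, …, q
- 1}`. Reduction modulo `q` therefore loses nothing: there are `g i` and `c` with `∑ i, g i (s i) =
c (f s)` and `c` injective on the range of `f`. If all senders apply one common matrix `M`, the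
channel itself computes `M` times the embedded block of values of `f`. What remains is to compress
the i.i.d. source `f(S)` into `n` symbols of `𝔽_q`. Achievability (`exists_code_realError_le`) is
random linear binning. Two distinct blocks of values collide with probability `q⁻ⁿ`, and about `exp
(k H)` blocks are typical, so the union bound succeeds when `k H` stays slightly below `n log q`. A
backoff that vanishes with `n` attains the limiting rate itself. The converse
(`BlockCode.one_sub_realError_le`) holds for arbitrary encoders. At most `qⁿ` blocks of values can
be decoded, each typical one has probability about `exp (-k H)`, so above the claimed rate the error
tends to one. -/

namespace ModSumChannel

/-! ### Chebyshev's inequality and information content for i.i.d. blocks with real weights. -/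

section FiniteProduct

variable {A β : Type*} [Fintype A]

theorem sum_prod_eq_one {w : A → ℝ} (hw : ∑ a, w a = 1) (k : ℕ) :
    ∑ s : Fin k → A, ∏ j, w (s j) = 1 := by
  classical
  have h := Finset.prod_univ_sum (fun _ : Fin k => (Finset.univ : Finset A)) (fun _ a => w a)
  rw [Fintype.piFinset_univ] at h
  rw [← h]
  simp [hw]

theorem sum_fin_succ_pi {k : ℕ} (F : (Fin (k + 1) → A) → ℝ) :
    ∑ s, F s = ∑ a, ∑ s : Fin k → A, F (Fin.cons a s) := by
  rw [← (Fin.consEquiv (fun _ : Fin (k + 1) => A)).sum_comp, Fintype.sum_prod_type]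
  rfl

theorem sum_prod_mul_sum {w X : A → ℝ} (hw : ∑ a, w a = 1) (hX : ∑ a, w a * X a = 0) (k : ℕ) :
    ∑ s : Fin k → A, (∏ j, w (s j)) * ∑ j, X (s j) = 0 := by
  induction k with
  | zero => simp
  | succ k ih =>
    rw [sum_fin_succ_pi]
    have h : ∀ a (s : Fin k → A), (∏ j, w ((Fin.cons a s : Fin (k + 1) → A) j)) *
        ∑ j, X ((Fin.cons a s : Fin (k + 1) → A) j) =
        w a * X a * ∏ j, w (s j) + w a * ((∏ j, w (s j)) * ∑ j, X (s j)) := by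
      intro a s
      simp only [Fin.prod_univ_succ, Fin.sum_univ_succ, Fin.cons_zero, Fin.cons_succ]
      ring
    simp only [h, Finset.sum_add_distrib, ← Finset.mul_sum, ih, sum_prod_eq_one hw]
    simp [hX]

/-- The second moment of a sum of independent copies of a centred variable. -/
theorem sum_prod_mul_sum_sq {w X : A → ℝ} (hw : ∑ a, w a = 1) (hX : ∑ a, w a * X a = 0)
    (k : ℕ) :
    ∑ s : Fin k → A, (∏ j, w (s j)) * (∑ j, X (s j)) ^ 2 = k * ∑ a, w a * X a ^ 2 := by
  induction k with
  | zero => simp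
  | succ k ih =>
    rw [sum_fin_succ_pi]
    have h : ∀ a (s : Fin k → A), (∏ j, w ((Fin.cons a s : Fin (k + 1) → A) j)) *
        (∑ j, X ((Fin.cons a s : Fin (k + 1) → A) j)) ^ 2 =
        w a * X a ^ 2 * ∏ j, w (s j) + 2 * (w a * X a) * ((∏ j, w (s j)) * ∑ j, X (s j)) +
          w a * ((∏ j, w (s j)) * (∑ j, X (s j)) ^ 2) := by
      intro a s
      simp only [Fin.prod_univ_succ, Fin.sum_univ_succ, Fin.cons_zero, Fin.cons_succ]
      ring
    simp only [h, Finset.sum_add_distrib, ← Finset.mul_sum, ih, sum_prod_eq_one hw,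
      sum_prod_mul_sum hw hX]
    rw [← Finset.sum_mul Finset.univ w, hw]
    simp only [mul_zero, mul_one, Finset.sum_const_zero]
    push_cast
    ring

open Classical in
theorem chebyshev_sum {w X : A → ℝ} (hw0 : ∀ a, 0 ≤ w a) (hw : ∑ a, w a = 1)
    (hX : ∑ a, w a * X a = 0) (k : ℕ) {t : ℝ} (ht : 0 < t) :
    (∑ s : Fin k → A, if t ≤ |∑ j, X (s j)| then ∏ j, w (s j) else 0) ≤
      k * (∑ a, w a * X a ^ 2) / t ^ 2 := by
  rw [le_div_iff₀ (by positivity), ← sum_prod_mul_sum_sq hw hX, Finset.sum_mul]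
  refine Finset.sum_le_sum fun s _ => ?_
  have hp : 0 ≤ ∏ j, w (s j) := Finset.prod_nonneg fun j _ => hw0 _
  split_ifs with h
  · refine mul_le_mul_of_nonneg_left ?_ hp
    rw [← sq_abs (∑ j, X (s j))]
    exact pow_le_pow_left₀ ht.le h 2
  · rw [zero_mul]
    positivity

open Classical in
/-- The mass that the law of `f` puts on `b`. -/
noncomputable def fiberMass (w : A → ℝ) (f : A → β) (b : β) : ℝ :=
  ∑ a, if f a = b then w a else 0

theorem fiberMass_nonneg {w : A → ℝ} (hw0 : ∀ a, 0 ≤ w a) (f : A → β) (b : β) :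
    0 ≤ fiberMass w f b :=
  Finset.sum_nonneg fun a _ => by split_ifs <;> simp [hw0]

theorem le_fiberMass {w : A → ℝ} (hw0 : ∀ a, 0 ≤ w a) (f : A → β) (a : A) :
    w a ≤ fiberMass w f (f a) := by
  classical
  have := Finset.single_le_sum (f := fun a' => if f a' = f a then w a' else 0)
    (fun a' _ => by split_ifs <;> simp [hw0]) (Finset.mem_univ a)
  simpa [fiberMass] using this

open Classical in
theorem sum_fiberMass_mul (w : A → ℝ) (f : A → β) (F : β → ℝ) :
    ∑ b ∈ Finset.univ.image f, fiberMass w f b * F b = ∑ a, w a * F (f a) := by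
  simp only [fiberMass, Finset.sum_mul]
  rw [Finset.sum_comm]
  refine Finset.sum_congr rfl fun a _ => ?_
  rw [Finset.sum_eq_single (f a)]
  · simp
  · intro b _ hb
    simp [hb.symm]
  · simp

open Classical in
-- Independence passes to the values of `f`: the law of a block of values is a product law.
theorem sum_fiber_prod (w : A → ℝ) (f : A → β) {k : ℕ} (u : Fin k → β) :
    (∑ s : Fin k → A, if (∀ j, f (s j) = u j) then ∏ j, w (s j) else 0) =
      ∏ j, fiberMass w f (u j) := by
  have h := Finset.prod_univ_sum (fun _ : Fin k => (Finset.univ : Finset A))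
    (fun j a => if f a = u j then w a else 0)
  rw [Fintype.piFinset_univ] at h
  simp only [fiberMass]
  rw [h]
  refine Finset.sum_congr rfl fun s _ => ?_
  rw [Finset.prod_ite_zero]
  simp

/-- The entropy of the law of `f`, as an average over its domain. -/
noncomputable def meanInfo (w : A → ℝ) (f : A → β) : ℝ :=
  ∑ a, w a * -Real.log (fiberMass w f (f a))

/-- The deviation of the information content of `f a` from its mean. -/
noncomputable def infoDev (w : A → ℝ) (f : A → β) (a : A) : ℝ :=
  -Real.log (fiberMass w f (f a)) - meanInfo w f

noncomputable def infoVar (w : A → ℝ) (f : A → β) : ℝ :=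
  ∑ a, w a * infoDev w f a ^ 2

theorem sum_mul_infoDev {w : A → ℝ} (hw : ∑ a, w a = 1) (f : A → β) :
    ∑ a, w a * infoDev w f a = 0 := by
  simp only [infoDev, mul_sub, Finset.sum_sub_distrib, ← Finset.sum_mul, hw]
  simp [meanInfo]

theorem infoVar_nonneg {w : A → ℝ} (hw0 : ∀ a, 0 ≤ w a) (f : A → β) : 0 ≤ infoVar w f :=
  Finset.sum_nonneg fun a _ => mul_nonneg (hw0 a) (sq_nonneg _)

/-- Turns control of the sum of deviations into control of the block probability. Positive weight
keeps every factor away from `0`, where `Real.log` takes a default value. -/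
theorem prod_fiberMass_eq_exp {w : A → ℝ} (hw0 : ∀ a, 0 ≤ w a) (f : A → β) {k : ℕ}
    (s : Fin k → A) (hs : 0 < ∏ j, w (s j)) :
    ∏ j, fiberMass w f (f (s j)) =
      Real.exp (-(k * meanInfo w f + ∑ j, infoDev w f (s j))) := by
  have hpos : ∀ j, 0 < fiberMass w f (f (s j)) := fun j =>
    (lt_of_le_of_ne (hw0 _) fun h =>
      hs.ne' (Finset.prod_eq_zero (Finset.mem_univ j) h.symm)).trans_le (le_fiberMass hw0 f _)
  rw [← Real.exp_log (Finset.prod_pos fun j _ => hpos j),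
    Real.log_prod fun j _ => (hpos j).ne']
  congr 1
  simp [infoDev]

end FiniteProduct

/-! ### From `PMF` and `[0, ∞]`-valued entropy to real weights. -/

section Source

variable {A β : Type*} [Fintype A]

theorem sum_toReal_pmf (P : PMF A) : ∑ a, (P a).toReal = 1 := by
  rw [← ENNReal.toReal_sum fun a _ => P.apply_ne_top a, ← tsum_fintype (L := .unconditional _),
    P.tsum_coe]
  simp

theorem map_apply_toReal (P : PMF A) (f : A → β) (b : β) :
    ((P.map f) b).toReal = fiberMass (fun a => (P a).toReal) f b := by
  classical
  rw [PMF.map_apply, tsum_fintype, ENNReal.toReal_sum]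
  · refine Finset.sum_congr rfl fun a _ => ?_
    by_cases h : f a = b
    · simp [h]
    · simp [h, Ne.symm h]
  · intro a _
    split_ifs
    · exact P.apply_ne_top a
    · simp

theorem entropy_map (P : PMF A) (f : A → β) :
    entropy (P.map f) = ENNReal.ofReal (meanInfo (fun a => (P a).toReal) f) := by
  classical
  have hle : ∀ b, ((P.map f) b).toReal ≤ 1 := fun b =>
    ENNReal.toReal_le_of_le_ofReal zero_le_one (by simpa using (P.map f).coe_le_one b)
  unfold entropy
  rw [tsum_eq_sum (s := Finset.univ.image f), ← ENNReal.ofReal_sum_of_nonneg]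
  · congr 1
    rw [meanInfo, ← sum_fiberMass_mul _ f (fun b => -Real.log (fiberMass _ f b))]
    refine Finset.sum_congr rfl fun b _ => ?_
    rw [map_apply_toReal, Real.negMulLog]
    ring
  · intro b _
    exact Real.negMulLog_nonneg ENNReal.toReal_nonneg (hle b)
  · intro b hb
    have : (P.map f) b = 0 := by
      rw [PMF.apply_eq_zero_iff, PMF.mem_support_map_iff]
      rintro ⟨a, -, rfl⟩
      exact hb (Finset.mem_image_of_mem f (Finset.mem_univ a))
    simp [this]

theorem mul_info_nonneg (P : PMF A) (f : A → β) (a : A) :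
    0 ≤ (P a).toReal * -Real.log (fiberMass (fun a => (P a).toReal) f (f a)) := by
  refine mul_nonneg ENNReal.toReal_nonneg ?_
  rw [neg_nonneg, ← map_apply_toReal]
  refine Real.log_nonpos ENNReal.toReal_nonneg ?_
  exact ENNReal.toReal_le_of_le_ofReal zero_le_one (by simpa using (P.map f).coe_le_one _)

theorem meanInfo_nonneg (P : PMF A) (f : A → β) :
    0 ≤ meanInfo (fun a => (P a).toReal) f :=
  Finset.sum_nonneg fun a _ => mul_info_nonneg P f a

end Source

/-! ### Strong converse for one code. -/

open Classical in
/-- The error probability as a real number. -/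
noncomputable def BlockCode.realError {K p q n k : ℕ} {β : Type*} (C : BlockCode K p q n k β)
    (w : (Fin K → Fin p) → ℝ) (f : (Fin K → Fin p) → β) : ℝ :=
  ∑ s : Fin k → Fin K → Fin p,
    if ∃ j, C.decode j (C.output s) ≠ f (s j) then ∏ j, w (s j) else 0

theorem BlockCode.errorProb_eq {K p q n k : ℕ} {β : Type*} (C : BlockCode K p q n k β)
    (P : PMF (Fin K → Fin p)) (f : (Fin K → Fin p) → β) :
    C.errorProb P f = ENNReal.ofReal (C.realError (fun a => (P a).toReal) f) := by
  classical
  rw [BlockCode.errorProb, BlockCode.realError, ENNReal.ofReal_sum_of_nonneg]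
  · refine Finset.sum_congr rfl fun s _ => ?_
    split_ifs
    · rw [ENNReal.ofReal_prod_of_nonneg fun j _ => ENNReal.toReal_nonneg]
      exact Finset.prod_congr rfl fun j _ => (ENNReal.ofReal_toReal (P.apply_ne_top _)).symm
    · simp
  · intro s _
    split_ifs
    · exact Finset.prod_nonneg fun j _ => ENNReal.toReal_nonneg
    · exact le_rfl

/-- Strong converse for a single code: few blocks of values can be decoded correctly, and each of
the typical ones has small probability. -/
theorem BlockCode.one_sub_realError_le {K p q n k : ℕ} [NeZero q] {β : Type*}
    (C : BlockCode K p q n k β) {w : (Fin K → Fin p) → ℝ} (hw0 : ∀ a, 0 ≤ w a)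
    (hw : ∑ a, w a = 1) (f : (Fin K → Fin p) → β) {t : ℝ} (ht : 0 < t) :
    1 - C.realError w f ≤ k * infoVar w f / t ^ 2 +
      (q : ℝ) ^ n * Real.exp (-(k * meanInfo w f - t)) := by
  classical
  have hp : ∀ s : Fin k → Fin K → Fin p, 0 ≤ ∏ j, w (s j) := fun s =>
    Finset.prod_nonneg fun j _ => hw0 _
  rw [← sum_prod_eq_one hw k, BlockCode.realError, ← Finset.sum_sub_distrib]
  have hy : ∀ y : Fin n → ZMod q, (∑ s : Fin k → Fin K → Fin p,
      if (∀ j, f (s j) = C.decode j y) ∧ |∑ j, infoDev w f (s j)| < t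
        then ∏ j, w (s j) else 0) ≤ Real.exp (-(k * meanInfo w f - t)) := by
    intro y
    -- For fixed `y` the decoder names a single block of values. One typical `s0` of positive weight
    -- producing it suffices to bound the probability of that block; without such an `s0` the sum
    -- vanishes.
    by_cases hex : ∃ s0 : Fin k → Fin K → Fin p, 0 < ∏ j, w (s0 j) ∧
        (∀ j, f (s0 j) = C.decode j y) ∧ |∑ j, infoDev w f (s0 j)| < t
    · obtain ⟨s0, hs0, hf, hlt⟩ := hex
      calc _ ≤ ∑ s : Fin k → Fin K → Fin p,
            if (∀ j, f (s j) = C.decode j y) then ∏ j, w (s j) else 0 := by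
            refine Finset.sum_le_sum fun s _ => ?_
            by_cases h1 : ∀ j, f (s j) = C.decode j y
            · by_cases h2 : |∑ j, infoDev w f (s j)| < t <;> simp [h1, h2, hp]
            · simp [h1]
        _ = ∏ j, fiberMass w f (f (s0 j)) := by
            rw [sum_fiber_prod]
            exact Finset.prod_congr rfl fun j _ => by rw [hf]
        _ ≤ _ := by
            rw [prod_fiberMass_eq_exp hw0 f s0 hs0, Real.exp_le_exp]
            linarith [(abs_lt.1 hlt).1]
    · push Not at hex
      rw [Finset.sum_eq_zero]
      · positivity
      · intro s _
        rcases (hp s).eq_or_lt with h | h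
        · simp [← h]
        · rw [if_neg]
          rintro ⟨h1, h2⟩
          exact absurd h2 (not_lt.2 (hex s h h1))
  calc _ ≤ ∑ s : Fin k → Fin K → Fin p, ((if t ≤ |∑ j, infoDev w f (s j)|
          then ∏ j, w (s j) else 0) + ∑ y : Fin n → ZMod q,
          if (∀ j, f (s j) = C.decode j y) ∧ |∑ j, infoDev w f (s j)| < t
            then ∏ j, w (s j) else 0) := by
        refine Finset.sum_le_sum fun s _ => ?_
        have hn : ∀ y ∈ (Finset.univ : Finset (Fin n → ZMod q)), 0 ≤
            if (∀ j, f (s j) = C.decode j y) ∧ |∑ j, infoDev w f (s j)| < t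
              then ∏ j, w (s j) else 0 := fun y _ => by split_ifs <;> simp [hp]
        by_cases h1 : ∃ j, C.decode j (C.output s) ≠ f (s j)
        · rw [if_pos h1, sub_self]
          exact add_nonneg (by split_ifs <;> simp [hp]) (Finset.sum_nonneg hn)
        · rw [if_neg h1, sub_zero]
          push Not at h1
          by_cases h2 : t ≤ |∑ j, infoDev w f (s j)|
          · rw [if_pos h2]
            exact le_add_of_nonneg_right (Finset.sum_nonneg hn)
          · rw [if_neg h2, zero_add]
            refine le_trans ?_ (Finset.single_le_sum hn (Finset.mem_univ (C.output s)))
            rw [if_pos ⟨fun j => (h1 j).symm, not_le.1 h2⟩]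
    _ ≤ _ := by
        rw [Finset.sum_add_distrib]
        refine add_le_add (chebyshev_sum hw0 hw (sum_mul_infoDev hw f) k ht) ?_
        rw [Finset.sum_comm]
        refine (Finset.sum_le_sum fun y _ => hy y).trans ?_
        simp

/-! ### Typical blocks of values and random linear coding. -/

/-- A uniformly random matrix maps a fixed nonzero vector to zero with probability `q⁻ⁿ`. -/
theorem card_mulVec_eq_zero {q n : ℕ} [Fact q.Prime] {ι : Type*} [Fintype ι]
    [DecidableEq ι]     {v : ι → ZMod q} (hv : v ≠ 0) :
    (Finset.univ.filter fun M : Matrix (Fin n) ι (ZMod q) => M.mulVec v = 0).card * q ^ n =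
      Fintype.card (Matrix (Fin n) ι (ZMod q)) := by
  let Φ : Matrix (Fin n) ι (ZMod q) →+ (Fin n → ZMod q) :=
    { toFun := fun M => M.mulVec v
      map_zero' := Matrix.zero_mulVec v
      map_add' := fun M N => Matrix.add_mulVec M N v }
  obtain ⟨i, hi⟩ := Function.ne_iff.1 hv
  have hsurj : Function.Surjective Φ := fun y => by
    -- A matrix supported on column `i`, where `v i ≠ 0`, reaches any `y`. The kernel of `M ↦ M v`
    -- then has index `qⁿ`.
    refine ⟨fun r j => if j = i then y r / v i else 0, ?_⟩
    ext r
    have hi' : v i ≠ 0 := hi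
    simp [Φ, Matrix.mulVec, dotProduct, hi']
  have h1 := AddSubgroup.card_eq_card_quotient_mul_card_addSubgroup Φ.ker
  rw [Nat.card_congr (QuotientAddGroup.quotientKerEquivOfSurjective Φ hsurj).toEquiv] at h1
  have h2 : Nat.card Φ.ker =
      (Finset.univ.filter fun M : Matrix (Fin n) ι (ZMod q) => M.mulVec v = 0).card := by
    rw [Nat.card_eq_fintype_card]
    exact Fintype.card_of_subtype _ fun M => by simp [Φ, AddMonoidHom.mem_ker]
  rw [← Nat.card_eq_fintype_card, h1, h2, mul_comm]
  simp

section Typical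

variable {A β : Type*} [Fintype A]

open Classical in
/-- The blocks of values of `f` that have probability at least `exp (-c)`. -/
noncomputable def typicalSet (w : A → ℝ) (f : A → β) (k : ℕ) (c : ℝ) : Finset (Fin k → β) :=
  (Fintype.piFinset fun _ => Finset.univ.image f).filter
    fun u => Real.exp (-c) ≤ ∏ j, fiberMass w f (u j)

theorem card_typicalSet_le {w : A → ℝ} (hw0 : ∀ a, 0 ≤ w a) (hw : ∑ a, w a = 1) (f : A → β)
    (k : ℕ) (c : ℝ) : ((typicalSet w f k c).card : ℝ) ≤ Real.exp c := by
  classical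
  have hn : ∀ u : Fin k → β, 0 ≤ ∏ j, fiberMass w f (u j) := fun u =>
    Finset.prod_nonneg fun j _ => fiberMass_nonneg hw0 f _
  have h1 : ((typicalSet w f k c).card : ℝ) * Real.exp (-c) ≤ 1 :=
    calc _ = ∑ u ∈ typicalSet w f k c, Real.exp (-c) := by simp
      _ ≤ ∑ u ∈ typicalSet w f k c, ∏ j, fiberMass w f (u j) :=
          Finset.sum_le_sum fun u hu => (Finset.mem_filter.1 hu).2
      _ ≤ ∑ u ∈ Fintype.piFinset fun _ => Finset.univ.image f, ∏ j, fiberMass w f (u j) :=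
          Finset.sum_le_sum_of_subset_of_nonneg (Finset.filter_subset _ _) fun u _ _ => hn u
      _ = 1 := by
          rw [← Finset.prod_univ_sum (fun _ : Fin k => Finset.univ.image f)
            (fun _ b => fiberMass w f b)]
          have := sum_fiberMass_mul w f (fun _ => 1)
          simp only [mul_one, hw] at this
          convert Finset.prod_const_one with j
  rw [Real.exp_neg, ← div_eq_mul_inv, div_le_one (Real.exp_pos c)] at h1
  exact h1

open Classical in
theorem sum_not_mem_typicalSet_le {w : A → ℝ} (hw0 : ∀ a, 0 ≤ w a) (hw : ∑ a, w a = 1)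
    (f : A → β) (k : ℕ) {t : ℝ} (ht : 0 < t) :
    (∑ s : Fin k → A, if (fun j => f (s j)) ∉ typicalSet w f k (k * meanInfo w f + t)
      then ∏ j, w (s j) else 0) ≤ k * infoVar w f / t ^ 2 := by
  refine le_trans (Finset.sum_le_sum fun s _ => ?_)
    (chebyshev_sum hw0 hw (sum_mul_infoDev hw f) k ht)
  have hp : 0 ≤ ∏ j, w (s j) := Finset.prod_nonneg fun j _ => hw0 _
  rcases hp.eq_or_lt with h | h
  · simp [← h]
  · by_cases hs : t ≤ |∑ j, infoDev w f (s j)|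
    · rw [if_pos hs]
      split_ifs <;> simp [hp]
    · rw [if_neg hs, if_neg]
      rw [not_not, typicalSet, Finset.mem_filter, prod_fiberMass_eq_exp hw0 f s h,
        Real.exp_le_exp]
      refine ⟨by simp [Fintype.mem_piFinset], ?_⟩
      linarith [(abs_lt.1 (not_le.1 hs)).2]

end Typical

/-- The linear code with generator matrix `M`: sender `i` maps its symbols through `g i` and
multiplies the resulting vector by `M`; the receiver looks for a block of values in `T` whose
image under `c` is consistent with the channel output. -/
noncomputable def linearCode {K p q n k m : ℕ} {β : Type*} [Nonempty β]
    (g : Fin K → Fin p → Fin m → ZMod q) (c : β → Fin m → ZMod q)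
    (M : Matrix (Fin n) (Fin k × Fin m) (ZMod q)) (T : Finset (Fin k → β)) :
    BlockCode K p q n k β where
  encode i x := M.mulVec fun a => g i (x a.1) a.2
  decode j y := Classical.epsilon (fun u => u ∈ T ∧ M.mulVec (fun a => c (u a.1) a.2) = y) j

theorem linearCode_output {K p q n k m : ℕ} {β : Type*} [Nonempty β]
    {g : Fin K → Fin p → Fin m → ZMod q} {c : β → Fin m → ZMod q}
    {f : (Fin K → Fin p) → β} (hg : ∀ s, ∑ i, g i (s i) = c (f s))
    (M : Matrix (Fin n) (Fin k × Fin m) (ZMod q)) (T : Finset (Fin k → β))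
    (s : Fin k → Fin K → Fin p) :
    (linearCode g c M T).output s = M.mulVec fun a => c (f (s a.1)) a.2 := by
  simp only [BlockCode.output, linearCode, ← hg, Finset.sum_apply]
  rw [← Matrix.mulVec_sum]
  congr 1
  ext a
  simp

open Classical in
/-- Random linear coding: the error probability averaged over all generator matrices. -/
theorem exists_code_realError_le {K p q n k m : ℕ} [Fact q.Prime] {β : Type*}
    {g : Fin K → Fin p → Fin m → ZMod q} {c : β → Fin m → ZMod q}
    {f : (Fin K → Fin p) → β} (hg : ∀ s, ∑ i, g i (s i) = c (f s))
    (hc : Set.InjOn c (Set.range f)) {w : (Fin K → Fin p) → ℝ} (hw0 : ∀ a, 0 ≤ w a)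
    (hw : ∑ a, w a = 1) {t : ℝ} (ht : 0 < t) :
    ∃ C : BlockCode K p q n k β, C.realError w f ≤ k * infoVar w f / t ^ 2 +
      Real.exp (k * meanInfo w f + t) / (q : ℝ) ^ n := by
  have : Nonempty (Fin K → Fin p) := by
    by_contra h
    rw [not_nonempty_iff] at h
    simp at hw
  have : Nonempty β := Nonempty.map f inferInstance
  set T := typicalSet w f k (k * meanInfo w f + t) with hT
  -- The event that `M` fails to separate the embedded blocks `u` and `u'`.
  let N : (Fin k → β) → (Fin k → β) → Matrix (Fin n) (Fin k × Fin m) (ZMod q) → Prop :=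
    fun u u' M => M.mulVec ((fun a => c (u a.1) a.2) - fun a => c (u' a.1) a.2) = 0
  have hp : ∀ s : Fin k → Fin K → Fin p, 0 ≤ ∏ j, w (s j) := fun s =>
    Finset.prod_nonneg fun j _ => hw0 _
  have hq : (0 : ℝ) < (q : ℝ) ^ n := by
    have := (Fact.out : q.Prime).pos
    positivity
  obtain ⟨D, hD⟩ : ∃ D : ℝ, D = ((Fintype.card (Matrix (Fin n) (Fin k × Fin m) (ZMod q)) : ℕ) : ℝ) :=
    ⟨_, rfl⟩
  have hDpos : 0 < D := by
    rw [hD]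
    exact_mod_cast Fintype.card_pos
  have hN : ∀ u ∈ T, ∀ s : Fin k → Fin K → Fin p, u ≠ (fun j => f (s j)) →
      (∑ M, if N u (fun j => f (s j)) M then (1 : ℝ) else 0) = D / (q : ℝ) ^ n := by
    intro u hu s hus
    have hv : ((fun a : Fin k × Fin m => c (u a.1) a.2) - fun a => c (f (s a.1)) a.2) ≠ 0 := by
      intro h0
      refine hus (funext fun j => ?_)
      have hmem := Fintype.mem_piFinset.1 (Finset.mem_filter.1 hu).1 j
      obtain ⟨a, -, ha⟩ := Finset.mem_image.1 hmem
      refine hc ⟨a, ha⟩ ⟨s j, rfl⟩ (funext fun l => ?_)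
      exact sub_eq_zero.1 (congrFun h0 (j, l))
    rw [eq_div_iff hq.ne', hD, ← card_mulVec_eq_zero hv, Finset.sum_boole]
    push_cast
    rfl
  -- Union bound: an error means that the true block is atypical or that a different block of `T`
  -- collides with it.
  have hM : ∀ M, (linearCode g c M T).realError w f ≤
      ∑ s : Fin k → Fin K → Fin p, ((if (fun j => f (s j)) ∉ T then ∏ j, w (s j) else 0) +
        (∏ j, w (s j)) * ∑ u ∈ T.filter (· ≠ fun j => f (s j)),
          if N u (fun j => f (s j)) M then (1 : ℝ) else 0) := by
    intro M
    refine Finset.sum_le_sum fun s _ => ?_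
    have hn : ∀ u ∈ T.filter (· ≠ fun j => f (s j)),
        (0 : ℝ) ≤ if N u (fun j => f (s j)) M then (1 : ℝ) else 0 :=
      fun u _ => by split_ifs <;> simp
    by_cases hs : (fun j => f (s j)) ∈ T
    · rw [if_neg (not_not.2 hs), zero_add]
      by_cases herr : ∃ j, (linearCode g c M T).decode j ((linearCode g c M T).output s) ≠ f (s j)
      · rw [if_pos herr]
        rw [linearCode_output hg] at herr
        obtain ⟨j, hj⟩ := herr
        have hspec := Classical.epsilon_spec (p := fun u => u ∈ T ∧
          M.mulVec (fun a => c (u a.1) a.2) = M.mulVec (fun a => c (f (s a.1)) a.2))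
          ⟨fun j => f (s j), hs, rfl⟩
        set u := Classical.epsilon (fun u => u ∈ T ∧
          M.mulVec (fun a => c (u a.1) a.2) = M.mulVec (fun a => c (f (s a.1)) a.2)) with hu
        have hne : u ≠ fun j => f (s j) := fun h => hj (congrFun h j)
        refine le_mul_of_one_le_right (hp s) ?_
        refine le_trans ?_ (Finset.single_le_sum hn (Finset.mem_filter.2 ⟨hspec.1, hne⟩))
        rw [if_pos]
        change M.mulVec _ = 0
        rw [Matrix.mulVec_sub, hspec.2, sub_self]
      · rw [if_neg herr]
        exact mul_nonneg (hp s) (Finset.sum_nonneg hn)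
    · rw [if_pos hs]
      have := mul_nonneg (hp s) (Finset.sum_nonneg hn)
      split_ifs
      · linarith
      · linarith [hp s]
  have havg : ∑ M : Matrix (Fin n) (Fin k × Fin m) (ZMod q), (linearCode g c M T).realError w f ≤
      ∑ _ : Matrix (Fin n) (Fin k × Fin m) (ZMod q), (k * infoVar w f / t ^ 2 +
        Real.exp (k * meanInfo w f + t) / (q : ℝ) ^ n) := by
    refine (Finset.sum_le_sum fun M _ => hM M).trans ?_
    simp only [Finset.sum_add_distrib, Finset.sum_const, Finset.card_univ, nsmul_eq_mul,
      ← hD]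
    refine add_le_add ?_ ?_
    · exact mul_le_mul_of_nonneg_left (sum_not_mem_typicalSet_le hw0 hw f k ht) hDpos.le
    · rw [Finset.sum_comm]
      calc _ ≤ ∑ s : Fin k → Fin K → Fin p, (∏ j, w (s j)) *
            (D * (Real.exp (k * meanInfo w f + t) / (q : ℝ) ^ n)) := by
            refine Finset.sum_le_sum fun s _ => ?_
            rw [← Finset.mul_sum, Finset.sum_comm]
            refine mul_le_mul_of_nonneg_left ?_ (hp s)
            rw [Finset.sum_congr rfl fun u hu =>
              hN u (Finset.mem_filter.1 hu).1 s (Finset.mem_filter.1 hu).2]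
            rw [Finset.sum_const, nsmul_eq_mul, ← mul_div_assoc, ← mul_div_assoc, mul_comm]
            refine div_le_div_of_nonneg_right (mul_le_mul_of_nonneg_left ?_ hDpos.le) hq.le
            refine le_trans ?_ (card_typicalSet_le hw0 hw f k _)
            exact_mod_cast Finset.card_le_card (Finset.filter_subset _ _)
        _ = _ := by
            rw [← Finset.sum_mul, sum_prod_eq_one hw, one_mul]
  obtain ⟨M, -, hM'⟩ := Finset.exists_le_of_sum_le Finset.univ_nonempty havg
  exact ⟨_, hM'⟩

/-! ### Passage to the limit in `n`. -/

variable {K p q : ℕ} {β : Type*} {P : PMF (Fin K → Fin p)} {f : (Fin K → Fin p) → β}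

theorem BlockCode.realError_nonneg {n k : ℕ} (C : BlockCode K p q n k β)
    {w : (Fin K → Fin p) → ℝ} (hw0 : ∀ a, 0 ≤ w a) (f : (Fin K → Fin p) → β) :
    0 ≤ C.realError w f :=
  Finset.sum_nonneg fun s _ => by
    split_ifs
    · exact Finset.prod_nonneg fun j _ => hw0 _
    · exact le_rfl

theorem IsAchievable.le_div [Fact q.Prime] {R : ℝ≥0∞} (hR : IsAchievable q P f R)
    (hH : 0 < meanInfo (fun a => (P a).toReal) f) :
    R ≤ ENNReal.ofReal (Real.log q / meanInfo (fun a => (P a).toReal) f) := by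
  obtain ⟨k, C, hk, herr⟩ := hR
  set w : (Fin K → Fin p) → ℝ := fun a => (P a).toReal with hw
  have hw0 : ∀ a, 0 ≤ w a := fun a => ENNReal.toReal_nonneg
  set H := meanInfo w f with hHdef
  have hq0 : (0 : ℝ) < q := by exact_mod_cast (Fact.out : q.Prime).pos
  have hlog : 0 < Real.log q := Real.log_pos (by exact_mod_cast (Fact.out : q.Prime).one_lt)
  by_contra! hlt
  obtain ⟨c, hc1, hc2⟩ := ENNReal.lt_iff_exists_nnreal_btwn.1 hlt
  have hcL : Real.log q / H < c := by
    have h := (ENNReal.ofReal_lt_iff_lt_toReal (by positivity) ENNReal.coe_ne_top).1 hc1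
    simpa using h
  have hc0 : (0 : ℝ) < c := lt_trans (by positivity) hcL
  have hev : ∀ᶠ n : ℕ in atTop, (c : ℝ) * n < k n := by
    filter_upwards [hk.eventually (lt_mem_nhds hc2), eventually_gt_atTop 0] with n hn hn0
    rw [ENNReal.lt_div_iff_mul_lt (Or.inl (by simp [hn0.ne'])) (Or.inl (by simp))] at hn
    exact_mod_cast hn
  have hkt : Tendsto (fun n => (k n : ℝ)) atTop atTop :=
    tendsto_atTop_mono' _ (hev.mono fun n h => h.le)
      (tendsto_natCast_atTop_atTop.const_mul_atTop hc0)
  -- Since `c * n < k n` eventually, `n log q ≤ k n (H - 2δ)`. Taking `t = δ k n` spends one `δ` on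
  -- typicality and leaves `exp (-δ k n)`.
  set δ := (H - Real.log q / c) / 2 with hδ
  have hδ0 : 0 < δ := by
    have : Real.log q / c < H := by
      rw [div_lt_iff₀ hc0]
      rwa [div_lt_iff₀ hH, mul_comm] at hcL
    rw [hδ]
    linarith
  have hbound : ∀ᶠ n : ℕ in atTop, 1 - (C n).realError w f ≤
      infoVar w f / δ ^ 2 / k n + Real.exp (-(δ * k n)) := by
    filter_upwards [hev, hkt.eventually_gt_atTop 0] with n hn hkn
    refine ((C n).one_sub_realError_le hw0 (sum_toReal_pmf P) f (mul_pos hδ0 hkn)).trans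
      (add_le_add (le_of_eq ?_) ?_)
    · field_simp
    · rw [← Real.exp_log (pow_pos hq0 n), ← Real.exp_add, Real.exp_le_exp, Real.log_pow]
      have h1 : (n : ℝ) * Real.log q ≤ k n * (Real.log q / c) := by
        rw [mul_div_assoc', le_div_iff₀ hc0]
        nlinarith
      have h2 : H = 2 * δ + Real.log q / c := by
        rw [hδ]
        ring
      rw [← hHdef, h2]
      nlinarith
  have hreal : Tendsto (fun n => (C n).realError w f) atTop (𝓝 0) := by
    have h := (ENNReal.tendsto_toReal ENNReal.zero_ne_top).comp herr
    refine h.congr fun n => ?_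
    simp only [Function.comp, BlockCode.errorProb_eq]
    exact ENNReal.toReal_ofReal ((C n).realError_nonneg hw0 f)
  have hlim := le_of_tendsto_of_tendsto (tendsto_const_nhds.sub hreal)
    ((tendsto_const_nhds.div_atTop hkt).add
      (Real.tendsto_exp_neg_atTop_nhds_zero.comp (hkt.const_mul_atTop hδ0))) hbound
  norm_num at hlim

/-- Any real-valued bound that vanishes asymptotically makes a rate achievable. -/
theorem isAchievable_of_bound {R : ℝ≥0∞} (k : ℕ → ℕ) (e : ℕ → ℝ)
    (hC : ∀ n, ∃ C : BlockCode K p q n (k n) β,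
      C.realError (fun a => (P a).toReal) f ≤ e n)
    (hk : Tendsto (fun n => (k n : ℝ≥0∞) / (n : ℝ≥0∞)) atTop (𝓝 R))
    (he : Tendsto e atTop (𝓝 0)) : IsAchievable q P f R := by
  choose C hC using hC
  refine ⟨k, C, hk, ?_⟩
  have h := ENNReal.tendsto_ofReal he
  rw [ENNReal.ofReal_zero] at h
  refine tendsto_of_tendsto_of_tendsto_of_le_of_le tendsto_const_nhds h (fun _ => zero_le) ?_
  intro n
  simp only [BlockCode.errorProb_eq]
  exact ENNReal.ofReal_le_ofReal (hC n)

theorem infoVar_eq_zero {A : Type*} [Fintype A] (P : PMF A) {f : A → β}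
    (hH : meanInfo (fun a => (P a).toReal) f = 0) :
    infoVar (fun a => (P a).toReal) f = 0 := by
  have hz := (Finset.sum_eq_zero_iff_of_nonneg fun a _ => mul_info_nonneg P f a).1 hH
  refine Finset.sum_eq_zero fun a ha => ?_
  have h := hz a ha
  rw [infoDev, hH, sub_zero, sq, ← mul_assoc, h, zero_mul]

section Achievability

variable {m : ℕ} [Fact q.Prime] {g : Fin K → Fin p → Fin m → ZMod q} {c : β → Fin m → ZMod q}

/-- At zero entropy the variance vanishes too, so with `t = 1` the coding bound does not depend on
`k`, and `k = n²` gives infinite rate. -/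
theorem isAchievable_top (hg : ∀ s, ∑ i, g i (s i) = c (f s)) (hc : Set.InjOn c (Set.range f))
    (hH : meanInfo (fun a => (P a).toReal) f = 0) : IsAchievable q P f ⊤ := by
  refine isAchievable_of_bound (fun n => n * n) (fun n => Real.exp 1 / (q : ℝ) ^ n) ?_ ?_ ?_
  · intro n
    obtain ⟨C, hC⟩ := exists_code_realError_le (n := n) (k := n * n) hg hc
      (fun a => ENNReal.toReal_nonneg) (sum_toReal_pmf P) one_pos
    refine ⟨C, hC.trans (le_of_eq ?_)⟩
    rw [infoVar_eq_zero P hH, hH]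
    simp
  · refine ENNReal.tendsto_nat_nhds_top.congr' ?_
    filter_upwards [eventually_gt_atTop 0] with n hn
    push_cast
    rw [mul_div_assoc, ENNReal.div_self (by simp [hn.ne']) (by simp), mul_one]
  · exact tendsto_const_nhds.div_atTop
      (tendsto_pow_atTop_atTop_of_one_lt (by exact_mod_cast (Fact.out : q.Prime).one_lt))

theorem isAchievable_div (hg : ∀ s, ∑ i, g i (s i) = c (f s))
    (hc : Set.InjOn c (Set.range f)) (hH : 0 < meanInfo (fun a => (P a).toReal) f) :
    IsAchievable q P f
      (ENNReal.ofReal (Real.log q / meanInfo (fun a => (P a).toReal) f)) := by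
  set w : (Fin K → Fin p) → ℝ := fun a => (P a).toReal with hw
  have hw0 : ∀ a, 0 ≤ w a := fun a => ENNReal.toReal_nonneg
  set H := meanInfo w f with hHdef
  have hq0 : (0 : ℝ) < q := by exact_mod_cast (Fact.out : q.Prime).pos
  have hlog : 0 < Real.log q := Real.log_pos (by exact_mod_cast (Fact.out : q.Prime).one_lt)
  -- The exponent makes `ε n → 0`, so no rate is lost, while `n ε² → ∞`, as Chebyshev with `t = n ε`
  -- requires. Of the backoff `2 ε`, one half absorbs `t` and the other leaves a collision term `exp
  -- (-t)`.
  let ε : ℕ → ℝ := fun n => (n : ℝ) ^ (-(1 / 4) : ℝ)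
  let a : ℕ → ℝ := fun n => (Real.log q - 2 * ε n) / H
  let k : ℕ → ℕ := fun n => ⌊(n : ℝ) * a n⌋₊
  let t : ℕ → ℝ := fun n => n * ε n
  have hε : Tendsto ε atTop (𝓝 0) :=
    (tendsto_rpow_neg_atTop (by norm_num)).comp tendsto_natCast_atTop_atTop
  have ha : Tendsto a atTop (𝓝 (Real.log q / H)) := by
    have := (tendsto_const_nhds (x := Real.log q)).sub (hε.const_mul 2) |>.div_const H
    simpa using this
  have hapos : ∀ᶠ n in atTop, 0 < a n := ha.eventually (lt_mem_nhds (by positivity))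
  have htt : Tendsto t atTop atTop := by
    refine ((tendsto_rpow_atTop (y := 3 / 4) (by norm_num)).comp
      tendsto_natCast_atTop_atTop).congr' ?_
    filter_upwards [eventually_gt_atTop 0] with n hn
    have hn' : (0 : ℝ) < n := by exact_mod_cast hn
    change (n : ℝ) ^ (3 / 4 : ℝ) = n * (n : ℝ) ^ (-(1 / 4) : ℝ)
    rw [← Real.rpow_one_add' hn'.le (by norm_num)]
    norm_num
  have hsq : Tendsto (fun n : ℕ => (n : ℝ) * ε n ^ 2) atTop atTop := by
    refine ((tendsto_rpow_atTop (y := 1 / 2) (by norm_num)).comp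
      tendsto_natCast_atTop_atTop).congr' ?_
    filter_upwards [eventually_gt_atTop 0] with n hn
    have hn' : (0 : ℝ) < n := by exact_mod_cast hn
    change (n : ℝ) ^ (1 / 2 : ℝ) = n * ((n : ℝ) ^ (-(1 / 4) : ℝ)) ^ 2
    rw [← Real.rpow_mul_natCast hn'.le, ← Real.rpow_one_add' hn'.le (by norm_num)]
    norm_num
  have hfloor : ∀ᶠ n in atTop, (k n : ℝ) ≤ n * a n := by
    filter_upwards [hapos] with n hn
    exact Nat.floor_le (by positivity)
  -- The fallback `t = 1` only serves `n = 0`, where `t n = 0`.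
  let e : ℕ → ℝ := fun n => if 0 < t n then
    k n * infoVar w f / t n ^ 2 + Real.exp (k n * H + t n) / (q : ℝ) ^ n else
    k n * infoVar w f / 1 ^ 2 + Real.exp (k n * H + 1) / (q : ℝ) ^ n
  refine isAchievable_of_bound k e ?_ ?_ ?_
  · intro n
    by_cases ht : 0 < t n
    · simp only [e, if_pos ht]
      exact exists_code_realError_le hg hc hw0 (sum_toReal_pmf P) ht
    · simp only [e, if_neg ht]
      exact exists_code_realError_le hg hc hw0 (sum_toReal_pmf P) one_pos
  · have hkn : Tendsto (fun n => (k n : ℝ) / n) atTop (𝓝 (Real.log q / H)) := by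
      have hlow : Tendsto (fun n : ℕ => a n - 1 / (n : ℝ)) atTop (𝓝 (Real.log q / H)) := by
        simpa using ha.sub tendsto_one_div_atTop_nhds_zero_nat
      refine tendsto_of_tendsto_of_tendsto_of_le_of_le' hlow ha ?_ ?_
      · filter_upwards [eventually_gt_atTop 0] with n hn
        have hn' : (0 : ℝ) < n := by exact_mod_cast hn
        have := Nat.sub_one_lt_floor ((n : ℝ) * a n)
        rw [le_div_iff₀ hn', sub_mul, one_div, inv_mul_cancel₀ hn'.ne', mul_comm]
        exact this.le
      · filter_upwards [hfloor, eventually_gt_atTop 0] with n hf hn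
        have hn' : (0 : ℝ) < n := by exact_mod_cast hn
        rw [div_le_iff₀ hn', mul_comm]
        exact hf
    refine (ENNReal.tendsto_ofReal hkn).congr' ?_
    filter_upwards [eventually_gt_atTop 0] with n hn
    rw [ENNReal.ofReal_div_of_pos (by exact_mod_cast hn), ENNReal.ofReal_natCast,
      ENNReal.ofReal_natCast]
  · have hup : Tendsto (fun n : ℕ => a n * infoVar w f / (n * ε n ^ 2) + Real.exp (-t n)) atTop
        (𝓝 0) := by
      have := ((ha.mul_const (infoVar w f)).div_atTop hsq).add
        (Real.tendsto_exp_neg_atTop_nhds_zero.comp htt)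
      simpa using this
    have hV := infoVar_nonneg hw0 f
    refine tendsto_of_tendsto_of_tendsto_of_le_of_le' tendsto_const_nhds hup ?_ ?_
    · refine Eventually.of_forall fun n => ?_
      simp only [e]
      split_ifs <;> positivity
    · filter_upwards [hfloor, eventually_gt_atTop 0, htt.eventually_gt_atTop 0] with n hf hn ht
      have hn' : (0 : ℝ) < n := by exact_mod_cast hn
      have hε0 : 0 < ε n := pos_of_mul_pos_right ht hn'.le
      simp only [e, if_pos ht]
      refine add_le_add ?_ ?_
      · calc _ ≤ (n * a n) * infoVar w f / t n ^ 2 := by gcongr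
          _ = _ := by
            simp only [t]
            field_simp
      · rw [← Real.exp_log (pow_pos hq0 n), ← Real.exp_sub, Real.exp_le_exp, Real.log_pow]
        have h1 : (k n : ℝ) * H ≤ n * a n * H := mul_le_mul_of_nonneg_right hf hH.le
        have h2 : n * a n * H = n * Real.log q - 2 * t n := by
          simp only [a, t]
          field_simp
        linarith

theorem isComputationCapacity_of_linear (hg : ∀ s, ∑ i, g i (s i) = c (f s))
    (hc : Set.InjOn c (Set.range f)) :
    IsComputationCapacity q P f (ENNReal.ofReal (Real.log q) / entropy (P.map f)) := by
  have hlog : 0 < Real.log q := Real.log_pos (by exact_mod_cast (Fact.out : q.Prime).one_lt)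
  rw [entropy_map]
  rcases (meanInfo_nonneg P f).eq_or_lt with h | h
  · rw [← h, ENNReal.ofReal_zero, ENNReal.div_zero (by simpa using hlog)]
    exact ⟨isAchievable_top hg hc h.symm, fun _ _ => le_top⟩
  · rw [← ENNReal.ofReal_div_of_pos h]
    exact ⟨isAchievable_div hg hc h, fun _ hR => IsAchievable.le_div hR h⟩

end Achievability

/-! ### Embedding the function values in `𝔽_q`. -/

theorem natCast_comp_injOn (q m : ℕ) :
    Set.InjOn (fun (v : Fin m → ℕ) l => (v l : ZMod q)) {v | ∀ l, v l < q} := by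
  intro u hu v hv h
  ext l
  have hl := (ZMod.natCast_eq_natCast_iff' _ _ _).1 (congrFun h l)
  rwa [Nat.mod_eq_of_lt (hu l), Nat.mod_eq_of_lt (hv l)] at hl

theorem arithSum_lt {K p L q : ℕ} (hqK : (p - 1) ^ 2 * K < q) (a : Fin L → Fin K → Fin p)
    (s : Fin K → Fin p) (l : Fin L) : arithSum a s l < q := by
  refine lt_of_le_of_lt ?_ hqK
  calc arithSum a s l ≤ ∑ _i : Fin K, (p - 1) ^ 2 := by
        refine Finset.sum_le_sum fun i _ => ?_
        rw [sq]
        exact Nat.mul_le_mul (Nat.le_sub_one_of_lt (a l i).2) (Nat.le_sub_one_of_lt (s i).2)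
    _ = _ := by simp [mul_comm]

/-- Counts are at most `K`, and `K ≤ (p - 1)² K` needs `p ≥ 2`. -/
theorem typeFun_lt {K p q : ℕ} (hp : 2 ≤ p) (hqK : (p - 1) ^ 2 * K < q)
    (s : Fin K → Fin p) (l : Fin p) : typeFun s l < q := by
  refine lt_of_le_of_lt ?_ hqK
  calc typeFun s l ≤ ∑ _i : Fin K, (p - 1) ^ 2 := by
        refine Finset.sum_le_sum fun i _ => le_trans ?_ (Nat.one_le_pow 2 (p - 1) (by omega))
        split_ifs <;> simp
    _ = _ := by simp [mul_comm]

end ModSumChannel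

theorem mainTheorem5 (K p q : ℕ) (hq : q.Prime) (hqK : (p - 1) ^ 2 * K < q)
    (P : PMF (Fin K → Fin p)) :
    (∀ (L : ℕ) (a : Fin L → Fin K → Fin p),
      ModSumChannel.IsComputationCapacity q P (ModSumChannel.arithSum a)
        (ENNReal.ofReal (Real.log q) /
          ModSumChannel.entropy (P.map (ModSumChannel.arithSum a)))) ∧
    ModSumChannel.IsComputationCapacity q P ModSumChannel.typeFun
      (ENNReal.ofReal (Real.log q) /
        ModSumChannel.entropy (P.map ModSumChannel.typeFun)) := by
  have : Fact q.Prime := ⟨hq⟩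
  refine ⟨fun L a => ?_, ?_⟩
  · refine ModSumChannel.isComputationCapacity_of_linear
      (g := fun i x l => ((a l i : ℕ) : ZMod q) * ((x : ℕ) : ZMod q))
      (c := fun v l => (v l : ZMod q)) (fun s => ?_)
      ((ModSumChannel.natCast_comp_injOn q L).mono ?_)
    · ext l
      simp [ModSumChannel.arithSum]
    · rintro _ ⟨s, rfl⟩
      exact ModSumChannel.arithSum_lt hqK a s
  · refine ModSumChannel.isComputationCapacity_of_linear
      (g := fun i x l => if x = l then 1 else 0)
      (c := fun v l => (v l : ZMod q)) (fun s => ?_) ?_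
    · ext l
      simp [ModSumChannel.typeFun]
    -- For `p = 1` the count `K` may be `q` or more, but there is only one source vector, so
    -- injectivity on the range is trivial.
    · rcases lt_or_ge p 2 with hp | hp
      · have : Subsingleton (Fin p) := Fin.subsingleton_iff_le_one.2 (by omega)
        rintro _ ⟨s, rfl⟩ _ ⟨s', rfl⟩ -
        rw [Subsingleton.elim s s']
      · refine (ModSumChannel.natCast_comp_injOn q p).mono ?_
        rintro _ ⟨s, rfl⟩
        exact ModSumChannel.typeFun_lt hp hqK s
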